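/- Let $N\ge 1$ and $N_f\ge 0$ be integers, $\epsilon\in\mathbb C\setminus\{0\}$, $a_1,\dots,a_N\in\mathbb C$ and $m_1,\dots,m_{N_f}\in\mathbb C$. Put $\epsilon_1=-\epsilon_2=\epsilon$ and $\alpha_i=a_i/\epsilon$, and assume $\alpha_i-\alpha_j\notin\mathbb Z$ for all $1\le i<j\le N$. For a Young diagram $Y$ let $Y_j$ be the height of its $j$-th column and $Y'_i$ the length of its $i$-th row (zero beyond the diagram), and for a box $s=(i,j)$ (row $i$, column $j$, not necessarily in $Y$) put $A_Y(s)=Y_j-i$ and $L_Y(s)=Y'_i-j$. Let $|Y|$ be the number of boxes of $Y$. The instanton partition function of the $U(N)$ gauge theory with $N_f$ fundamental multiplets of masses $m_1,\dots,m_{N_f}$ is the power series $\sum_{k\ge0}z_kq^k$ with $$z_k=\sum_{|Y_1|+\dots+|Y_N|=k}\ \prod_{i,j=1}^N\Bigl(\prod_{s\in Y_i}\frac{1}{a_i-a_j-\epsilon_1L_{Y_j}(s)+\epsilon_2(A_{Y_i}(s)+1)}\prod_{t\in Y_j}\frac{1}{a_i-a_j+\epsilon_1(L_{Y_i}(t)+1)-\epsilon_2A_{Y_j}(t)}\Bigr)\prod_{i=1}^N\prod_{(u,v)\in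 Y_i}\prod_{r=1}^{N_f}\bigl(a_i+\epsilon_1(u-1)+\epsilon_2(v-1)+m_r\bigr),$$ where the sum is over $N$-tuples $(Y_1,\dots,Y_N)$ of Young diagrams. Write $C_{ij}=\min_{n\in\mathbb Z}|\alpha_i-\alpha_j-n|$ and $$R=\prod_{\substack{1\le i,j\le N\\ i\ne j}}\left[\frac{16}{\min\{1,|\alpha_i-\alpha_j|\}}\left(1+\frac{|\alpha_i-\alpha_j|}{C_{ij}}\right)\right]^{-1}.$$ (1) If $N_f=2N$, then $R>0$, the series $\sum_k z_kq^k$ has radius of convergence at least $R$, and it converges absolutely for every $q\in\mathbb C$ with $|q|<R$. (2) If $N_f<2N$, then the series $\sum_k z_kq^k$ has infinite radius of convergence, i.e. it converges absolutely for every $q\in\mathbb C$. -/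

import Mathlib

open scoped ENNReal

noncomputable section

namespace Nekrasov

/- Young diagrams are Mathlib's `YoungDiagram`; the box `(i, j)` lies in row `i` and column `j`,
both counted from `0`. The arm and leg lengths below are `Y_j - i` and `Y'_i - j` for `1`-based
labels, where `Y_j` is the height of column `j` and `Y'_i` the length of row `i`. They are integers,
since they are also evaluated at boxes outside of `Y`, where they may be negative. -/

/-- Arm length `A_Y(s)` (vertical: height of the column of `s` minus row index of `s`). -/
def armLength (Y : YoungDiagram) (s : ℕ × ℕ) : ℤ :=
  (Y.colLen s.2 : ℤ) - ((s.1 : ℤ) + 1)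

/-- Leg length `L_Y(s)` (horizontal: length of the row of `s` minus column index of `s`). -/
def legLength (Y : YoungDiagram) (s : ℕ × ℕ) : ℤ :=
  (Y.rowLen s.1 : ℤ) - ((s.2 : ℤ) + 1)

/-- `E(a, Y, W, s) = a - ε₁ L_W(s) + ε₂ (A_Y(s) + 1)`. -/
def weightE (ε₁ ε₂ a : ℂ) (Y W : YoungDiagram) (s : ℕ × ℕ) : ℂ :=
  a - ε₁ * (legLength W s : ℂ) + ε₂ * ((armLength Y s : ℂ) + 1)

/-- `φ(a, s) = a + ε₁ (i - 1) + ε₂ (j - 1)` for the box `s = (i, j)` in `1`-based labels. -/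
def weightPhi (ε₁ ε₂ a : ℂ) (s : ℕ × ℕ) : ℂ :=
  a + ε₁ * (s.1 : ℂ) + ε₂ * (s.2 : ℂ)

/-- Contribution of the `U(N)` vector multiplet; the second factor is
`1 / (a_i - a_j + ε₁ (L_{Y_i}(t) + 1) - ε₂ A_{Y_j}(t))`. -/
def zVect {N : ℕ} (ε₁ ε₂ : ℂ) (a : Fin N → ℂ) (Y : Fin N → YoungDiagram) : ℂ :=
  ∏ i, ∏ j,
    (∏ s ∈ (Y i).cells, 1 / weightE ε₁ ε₂ (a i - a j) (Y i) (Y j) s) *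
    (∏ t ∈ (Y j).cells, 1 / (ε₁ + ε₂ - weightE ε₁ ε₂ (a j - a i) (Y j) (Y i) t))

/-- Contribution of one (anti)fundamental hypermultiplet of mass `m`. -/
def zMatter {N : ℕ} (ε₁ ε₂ : ℂ) (a : Fin N → ℂ) (Y : Fin N → YoungDiagram) (m : ℂ) : ℂ :=
  ∏ i, ∏ s ∈ (Y i).cells, (weightPhi ε₁ ε₂ (a i) s + m)

theorem cells_subset_of_card_le (Y : YoungDiagram) (k : ℕ) (h : Y.card ≤ k) :
    Y.cells ⊆ Finset.range k ×ˢ Finset.range k := by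
  rintro ⟨i, j⟩ hs
  rw [YoungDiagram.mem_cells] at hs
  have h1 : Y.colLen j ≤ Y.card := by
    rw [YoungDiagram.colLen_eq_card]
    exact Finset.card_le_card (Finset.filter_subset _ _)
  have h2 : Y.rowLen i ≤ Y.card := by
    rw [YoungDiagram.rowLen_eq_card]
    exact Finset.card_le_card (Finset.filter_subset _ _)
  have h3 := YoungDiagram.mem_iff_lt_colLen.1 hs
  have h4 := YoungDiagram.mem_iff_lt_rowLen.1 hs
  simp only [Finset.mem_product, Finset.mem_range]
  omega

theorem finite_youngTuples (N k : ℕ) :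
    {Y : Fin N → YoungDiagram | ∑ i, (Y i).card = k}.Finite := by
  have h : {Y : YoungDiagram | Y.card ≤ k}.Finite := by
    refine Set.Finite.of_finite_image (f := YoungDiagram.cells) ?_ ?_
    · refine ((Finset.range k ×ˢ Finset.range k).powerset.finite_toSet).subset ?_
      rintro _ ⟨Y, hY, rfl⟩
      simpa only [Finset.coe_powerset, Set.mem_preimage, Set.mem_powerset_iff, Finset.coe_subset]
        using cells_subset_of_card_le Y k hY
    · intro Y _ W _ hYW
      exact YoungDiagram.ext hYW
  refine (Set.Finite.pi' (fun _ : Fin N => h)).subset ?_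
  intro Y hY i
  rw [Set.mem_ofPred_eq] at hY ⊢
  rw [← hY]
  exact Finset.single_le_sum (f := fun i => (Y i).card) (fun _ _ => Nat.zero_le _)
    (Finset.mem_univ i)

/-- The `N`-tuples of Young diagrams with `k` boxes in total. -/
def youngTuples (N k : ℕ) : Finset (Fin N → YoungDiagram) :=
  (finite_youngTuples N k).toFinset

/-- The coefficient of `q ^ k` in the instanton partition function of the `U(N)` theory with
`Nf` (anti)fundamental hypermultiplets of masses `m r`, vacuum expectation values `a i` and
background parameters `ε₁, ε₂`. -/
def instantonCoeff {N Nf : ℕ} (ε₁ ε₂ : ℂ) (a : Fin N → ℂ) (m : Fin Nf → ℂ) (k : ℕ) : ℂ :=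
  ∑ Y ∈ youngTuples N k, zVect ε₁ ε₂ a Y * ∏ r, zMatter ε₁ ε₂ a Y (m r)

/-- The instanton partition function, as a power series in the instanton parameter `q`. -/
def instantonSeries {N Nf : ℕ} (ε₁ ε₂ : ℂ) (a : Fin N → ℂ) (m : Fin Nf → ℂ) :
    FormalMultilinearSeries ℂ ℂ ℂ :=
  FormalMultilinearSeries.ofScalars ℂ (instantonCoeff ε₁ ε₂ a m)

/-- The distance `min_{n ∈ ℤ} |z - n|` of `z` from the integers. -/
def distInt (z : ℂ) : ℝ := ⨅ n : ℤ, ‖z - (n : ℂ)‖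

/-- `∏_{i ≠ j} [16 / min{1, |α_i - α_j|} · (1 + |α_i - α_j| / C_ij)]⁻¹`, over ordered pairs, with
`C_ij = min_{n ∈ ℤ} |α_i - α_j - n|`. -/
def radiusBound {N : ℕ} (α : Fin N → ℂ) : ℝ :=
  ∏ p : Fin N × Fin N with p.1 ≠ p.2,
    (16 / min 1 ‖α p.1 - α p.2‖ * (1 + ‖α p.1 - α p.2‖ / distInt (α p.1 - α p.2)))⁻¹

end Nekrasov

end

/-! Since `ε₂ = -ε₁`, every vector weight is `ε` times `α i - α j` plus an integer, and that integer
is a difference of positions in the edge sequences of two diagrams. The logarithm of a product of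
weights is therefore minus a sum of `f n = log |z + n|` over such differences.

For arbitrary `f`, `sum_weights_eq` rewrites this sum as a sum over contents of boxes, minus a
correction which involves only the ends of the principal hooks. Summed over all pairs `(i, j)`, the
corrections form the logarithm of a squared Cauchy determinant (`sum_logNorm_cauchy_fin`). Its size
`D` is the total Durfee size, at most `N (√k + 1)`, and its entries are bounded by some `M`, so the
Leibniz expansion bounds it by `(D M) ^ D`, which is `exp (O(√k log k))`.

What remains is a product over boxes of a function of the content `c`, of order `|c| ^ (Nf - 2N)`.
It tends to `1` if `Nf = 2N` and to `0` if `Nf < 2N`. A diagram with at most `k` boxes has at most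
`√k + 1` boxes of each content, so finitely many exceptional contents cost only `exp (O(√k))`. The
number of tuples is also `exp (O(√k log k))`. Hence `|z_k| ≤ θ ^ k` eventually, for every `θ` above
the limit. The radius is at least `1` in the first case and infinite in the second, and
`radiusBound` is at most `1`. -/

namespace Nekrasov

/-! ### Edge sequences of Young diagrams -/

/-- Content `column - row` of a box. -/
def content (s : ℕ × ℕ) : ℤ := (s.2 : ℤ) - s.1

/-- Position in the edge sequence of `Y` of the end of row `r`. -/
def rowEnd (Y : YoungDiagram) (r : ℕ) : ℤ := (Y.rowLen r : ℤ) - r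

/-- Position in the edge sequence of `Y` of the end of column `c`. -/
def colEnd (Y : YoungDiagram) (c : ℕ) : ℤ := (c : ℤ) + 1 - Y.colLen c

/-- Makes the sum of `f` over an interval of integers a difference of two endpoint values, with no
case distinction on signs. -/
theorem exists_antidifference (f : ℤ → ℝ) : ∃ Φ : ℤ → ℝ, ∀ m, Φ (m + 1) - Φ m = f m := by
  refine ⟨fun m => (∑ i ∈ Finset.range m.toNat, f i)
    - ∑ i ∈ Finset.range (-m).toNat, f (-(i : ℤ) - 1), fun m => ?_⟩
  obtain ⟨n, rfl | rfl⟩ := m.eq_nat_or_neg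
  · have h1 : ((n : ℤ) + 1).toNat = n + 1 := by omega
    have h2 : (-((n : ℤ) + 1)).toNat = 0 := by omega
    have h3 : (-(n : ℤ)).toNat = 0 := by omega
    simp only [h1, h2, h3, Int.toNat_natCast, Finset.sum_range_succ]
    simp
  · rcases n with _ | n
    · simp
    · have h1 : (-((n + 1 : ℕ) : ℤ) + 1).toNat = 0 := by omega
      have h2 : (-(-((n + 1 : ℕ) : ℤ) + 1)).toNat = n := by omega
      have h3 : (-((n + 1 : ℕ) : ℤ)).toNat = 0 := by omega
      have h4 : (- -((n + 1 : ℕ) : ℤ)).toNat = n + 1 := by omega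
      simp only [h1, h2, h3, h4, Finset.sum_range_succ]
      have h5 : -((n + 1 : ℕ) : ℤ) = -(n : ℤ) - 1 := by push_cast; ring
      rw [h5]
      simp

theorem sum_range_sub_int (Φ : ℤ → ℝ) (a : ℤ) (n : ℕ) :
    ∑ i ∈ Finset.range n, (Φ (a + i + 1) - Φ (a + i)) = Φ (a + n) - Φ a := by
  induction n with
  | zero => simp
  | succ n ih =>
    rw [Finset.sum_range_succ, ih]
    push_cast
    rw [← add_assoc]
    ring

theorem mem_cells_iff_lt_rowLen {Y : YoungDiagram} {r c : ℕ} :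
    (r, c) ∈ Y.cells ↔ c < Y.rowLen r := by
  rw [YoungDiagram.mem_cells, YoungDiagram.mem_iff_lt_rowLen]

theorem mem_cells_iff_lt_colLen {Y : YoungDiagram} {r c : ℕ} :
    (r, c) ∈ Y.cells ↔ r < Y.colLen c := by
  rw [YoungDiagram.mem_cells, YoungDiagram.mem_iff_lt_colLen]

theorem lt_rowLen_iff_lt_colLen {Y : YoungDiagram} {r c : ℕ} :
    c < Y.rowLen r ↔ r < Y.colLen c := by
  rw [← mem_cells_iff_lt_rowLen, mem_cells_iff_lt_colLen]

theorem rowEnd_strictAnti (Y : YoungDiagram) : StrictAnti (rowEnd Y) := by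
  intro r r' h
  have := Y.rowLen_anti r r' h.le
  unfold rowEnd
  omega

theorem colEnd_strictMono (Y : YoungDiagram) : StrictMono (colEnd Y) := by
  intro c c' h
  have := Y.colLen_anti c c' h.le
  unfold colEnd
  omega

theorem rowLen_eq_zero {Y : YoungDiagram} {n r : ℕ} (hn : Y.colLen 0 ≤ n) (hr : n ≤ r) :
    Y.rowLen r = 0 := by
  by_contra h
  have := lt_rowLen_iff_lt_colLen.1 (Nat.pos_of_ne_zero h)
  omega

theorem sum_cells_eq_sum_rows (Y : YoungDiagram) {n : ℕ} (hn : Y.colLen 0 ≤ n) (F : ℕ × ℕ → ℝ) :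
    ∑ s ∈ Y.cells, F s = ∑ r ∈ Finset.range n, ∑ c ∈ Finset.range (Y.rowLen r), F (r, c) := by
  rw [Finset.sum_sigma', eq_comm]
  refine Finset.sum_bij' (fun x _ => (x.1, x.2)) (fun s _ => ⟨s.1, s.2⟩) ?_ ?_ ?_ ?_ ?_
  · rintro ⟨r, c⟩ h
    simp only [Finset.mem_sigma, Finset.mem_range] at h
    exact mem_cells_iff_lt_rowLen.2 h.2
  · rintro ⟨r, c⟩ h
    simp only [Finset.mem_sigma, Finset.mem_range]
    refine ⟨?_, mem_cells_iff_lt_rowLen.1 h⟩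
    by_contra h'
    have := mem_cells_iff_lt_rowLen.1 h
    rw [rowLen_eq_zero hn (not_lt.1 h')] at this
    omega
  · intros; rfl
  · intros; rfl
  · intros; rfl

/-- The column ends below position `rowEnd Y r`, together with the row ends up to that position,
exhaust an interval of integers. -/
theorem sum_colEnd_add_sum_rowEnd (Y : YoungDiagram) {n : ℕ} (hn : Y.colLen 0 ≤ n) (Γ : ℤ → ℝ)
    (g : ℤ → ℝ) (hg : ∀ m, Γ (m + 1) - Γ m = g m) {r : ℕ} (hr : r ≤ n) :
    ∑ c ∈ Finset.range (Y.rowLen r), g (colEnd Y c) + ∑ r' ∈ Finset.Ico r n, g (rowEnd Y r')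
      = Γ (rowEnd Y r + 1) - Γ (1 - n) := by
  induction hr using Nat.decreasingInduction with
  | self =>
    rw [rowEnd, rowLen_eq_zero hn le_rfl]
    simp [sub_eq_add_neg, add_comm]
  | of_succ r hr ih =>
    rw [Finset.sum_eq_sum_Ico_succ_bot hr]
    have hle := Y.rowLen_anti r (r + 1) (Nat.le_succ r)
    have hsplit : ∑ c ∈ Finset.range (Y.rowLen r), g (colEnd Y c)
        = ∑ c ∈ Finset.range (Y.rowLen (r + 1)), g (colEnd Y c)
          + (Γ (rowEnd Y r) - Γ (rowEnd Y (r + 1) + 1)) := by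
      rw [← Finset.sum_range_add_sum_Ico _ hle, Finset.sum_Ico_eq_sum_range]
      congr 1
      have h := sum_range_sub_int Γ (rowEnd Y (r + 1) + 1) (Y.rowLen r - Y.rowLen (r + 1))
      have e : rowEnd Y (r + 1) + 1 + ((Y.rowLen r - Y.rowLen (r + 1) : ℕ) : ℤ) = rowEnd Y r := by
        unfold rowEnd; omega
      rw [e] at h
      rw [← h]
      refine Finset.sum_congr rfl fun i hi => ?_
      rw [hg]
      congr 1
      rw [Finset.mem_range] at hi
      -- The columns between `rowLen (r + 1)` and `rowLen r` all have height exactly `r + 1`, so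
      -- their ends are consecutive integers.
      have h1 : r < Y.colLen (Y.rowLen (r + 1) + i) := lt_rowLen_iff_lt_colLen.1 (by omega)
      have h2 : ¬ r + 1 < Y.colLen (Y.rowLen (r + 1) + i) := by
        rw [← lt_rowLen_iff_lt_colLen]; omega
      unfold colEnd rowEnd
      push_cast
      omega
    rw [hsplit]
    have := hg (rowEnd Y r)
    linarith

theorem exists_diag_notMem (Y : YoungDiagram) : ∃ d, (d, d) ∉ Y.cells := by
  refine ⟨Y.rowLen 0, fun h => ?_⟩
  have h1 := mem_cells_iff_lt_rowLen.1 h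
  have := Y.rowLen_anti 0 (Y.rowLen 0) (Nat.zero_le _)
  omega

open Classical in
/-- Side length of the Durfee square. -/
noncomputable def durfee (Y : YoungDiagram) : ℕ := Nat.find (exists_diag_notMem Y)

theorem durfee_notMem (Y : YoungDiagram) : (durfee Y, durfee Y) ∉ Y.cells :=
  Nat.find_spec (exists_diag_notMem Y)

theorem diag_mem {Y : YoungDiagram} {u : ℕ} (h : u < durfee Y) : (u, u) ∈ Y.cells :=
  not_not.1 (Nat.find_min (exists_diag_notMem Y) h)

theorem mem_cells_of_le {Y : YoungDiagram} {r c r' c' : ℕ} (h : (r', c') ∈ Y.cells) (hr : r ≤ r')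
    (hc : c ≤ c') : (r, c) ∈ Y.cells :=
  Y.up_left_mem hr hc h

/-- Contents increase by one along a row, from `-r` to `rowEnd Y r - 1`, so each row telescopes; the
`-r` are the row ends of the empty diagram. -/
theorem sum_content_difference_rows (Y : YoungDiagram) {n : ℕ} (hn : Y.colLen 0 ≤ n)
    (g : ℤ → ℝ) :
    ∑ s ∈ Y.cells, (g (content s + 1) - g (content s))
      = ∑ r ∈ Finset.range n, (g (rowEnd Y r) - g (-(r : ℤ))) := by
  rw [sum_cells_eq_sum_rows Y hn]
  refine Finset.sum_congr rfl fun r _ => ?_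
  have h := sum_range_sub_int g (-(r : ℤ)) (Y.rowLen r)
  have e : -(r : ℤ) + Y.rowLen r = rowEnd Y r := by unfold rowEnd; ring
  rw [e] at h
  rw [← h]
  refine Finset.sum_congr rfl fun c _ => ?_
  have e : content (r, c) = -(r : ℤ) + c := by unfold content; ring
  rw [e]

/-- Telescoping along the principal hooks. -/
theorem sum_content_difference (Y : YoungDiagram) (g : ℤ → ℝ) :
    ∑ s ∈ Y.cells, (g (content s + 1) - g (content s))
      = ∑ u ∈ Finset.range (durfee Y), (g (rowEnd Y u) - g (colEnd Y u)) := by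
  obtain ⟨n, hn, hd⟩ : ∃ n, Y.colLen 0 ≤ n ∧ durfee Y ≤ n :=
    ⟨max _ _, le_max_left _ _, le_max_right _ _⟩
  obtain ⟨Γ, hΓ⟩ := exists_antidifference g
  rw [sum_content_difference_rows Y hn]
  have hmain := sum_colEnd_add_sum_rowEnd Y hn Γ g hΓ hd
  have hle : Y.rowLen (durfee Y) ≤ durfee Y := by
    by_contra h
    exact durfee_notMem Y (mem_cells_iff_lt_rowLen.2 (not_le.1 h))
  have hcol : ∑ c ∈ Finset.range (durfee Y), g (colEnd Y c)
      = ∑ c ∈ Finset.range (Y.rowLen (durfee Y)), g (colEnd Y c)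
        + (Γ 1 - Γ (rowEnd Y (durfee Y) + 1)) := by
    rw [← Finset.sum_range_add_sum_Ico _ hle, Finset.sum_Ico_eq_sum_range]
    congr 1
    have h := sum_range_sub_int Γ (rowEnd Y (durfee Y) + 1) (durfee Y - Y.rowLen (durfee Y))
    have e : rowEnd Y (durfee Y) + 1 + ((durfee Y - Y.rowLen (durfee Y) : ℕ) : ℤ) = 1 := by
      unfold rowEnd; omega
    rw [e] at h
    rw [← h]
    refine Finset.sum_congr rfl fun i hi => ?_
    rw [hΓ]
    congr 1
    rw [Finset.mem_range] at hi
    -- These columns reach the last row of the Durfee square but not the next row, so their height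
    -- is exactly `durfee Y`.
    have h1 : (durfee Y - 1, Y.rowLen (durfee Y) + i) ∈ Y.cells :=
      mem_cells_of_le (diag_mem (u := durfee Y - 1) (by omega)) le_rfl (by omega)
    have h2 := mem_cells_iff_lt_colLen.1 h1
    have h3 : ¬ durfee Y < Y.colLen (Y.rowLen (durfee Y) + i) := by
      rw [← lt_rowLen_iff_lt_colLen]; omega
    unfold colEnd rowEnd
    push_cast
    omega
  have hvac : ∑ r ∈ Finset.range n, g (-(r : ℤ)) = Γ 1 - Γ (1 - n) := by
    have h := sum_range_sub_int (fun m => - Γ (1 - m)) 0 n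
    simp only [zero_add] at h
    rw [show Γ 1 - Γ (1 - n) = -Γ (1 - n) - -Γ (1 - 0) by rw [sub_zero]; ring, ← h]
    refine Finset.sum_congr rfl fun r _ => ?_
    rw [← hΓ, show 1 - ((r : ℤ) + 1) = -(r : ℤ) by ring, show 1 - (r : ℤ) = -(r : ℤ) + 1 by ring]
    ring
  rw [Finset.sum_sub_distrib, Finset.sum_sub_distrib, hvac, hcol,
    ← Finset.sum_range_add_sum_Ico _ hd]
  linarith

/-! ### Arm-leg weights as sums over contents and principal hooks -/

theorem sum_colEnd_sub_rowEnd (Y W : YoungDiagram) {n : ℕ} (hY : Y.colLen 0 ≤ n)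
    {f Φ : ℤ → ℝ} (hΦ : ∀ m, Φ (m + 1) - Φ m = f m) :
    ∑ s ∈ Y.cells, f (colEnd Y s.2 - rowEnd W s.1)
      = ∑ r ∈ Finset.range n, (Φ (rowEnd Y r - rowEnd W r + 1) - Φ (1 - n - rowEnd W r)
          - ∑ r' ∈ Finset.Ico r n, f (rowEnd Y r' - rowEnd W r)) := by
  rw [sum_cells_eq_sum_rows Y hY]
  refine Finset.sum_congr rfl fun r hr => ?_
  have h := sum_colEnd_add_sum_rowEnd Y hY (fun m => Φ (m - rowEnd W r))
    (fun m => f (m - rowEnd W r)) (fun m => by rw [← hΦ]; ring_nf) (Finset.mem_range.1 hr).le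
  rw [show rowEnd Y r - rowEnd W r + 1 = rowEnd Y r + 1 - rowEnd W r by ring]
  linarith

theorem sum_rowEnd_sub_colEnd (Y W : YoungDiagram) {n : ℕ} (hW : W.colLen 0 ≤ n) {f Φ : ℤ → ℝ}
    (hΦ : ∀ m, Φ (m + 1) - Φ m = f m) :
    ∑ t ∈ W.cells, f (rowEnd Y t.1 - colEnd W t.2)
      = ∑ r ∈ Finset.range n, (Φ (rowEnd Y r + n) - Φ (rowEnd Y r - rowEnd W r)
          - ∑ r' ∈ Finset.Ico r n, f (rowEnd Y r - rowEnd W r')) := by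
  rw [sum_cells_eq_sum_rows W hW]
  refine Finset.sum_congr rfl fun r hr => ?_
  have h := sum_colEnd_add_sum_rowEnd W hW (fun m => -Φ (rowEnd Y r - m + 1))
    (fun m => f (rowEnd Y r - m)) (fun m => by rw [← hΦ]; ring_nf) (Finset.mem_range.1 hr).le
  rw [show rowEnd Y r - (rowEnd W r + 1) + 1 = rowEnd Y r - rowEnd W r by ring,
    show rowEnd Y r - (1 - (n : ℤ)) + 1 = rowEnd Y r + n by ring] at h
  linarith

theorem sum_Ico_add_sum_Ico (n : ℕ) (F : ℕ → ℕ → ℝ) :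
    ∑ r ∈ Finset.range n, (∑ r' ∈ Finset.Ico r n, F r' r + ∑ r' ∈ Finset.Ico r n, F r r')
      = ∑ r ∈ Finset.range n, ∑ r' ∈ Finset.range n, F r r' + ∑ r ∈ Finset.range n, F r r := by
  have h : ∑ r ∈ Finset.range n, ∑ r' ∈ Finset.Ico r n, F r' r
      = ∑ r ∈ Finset.range n, ∑ r' ∈ Finset.range (r + 1), F r r' := by
    refine Finset.sum_comm' fun x y => ?_
    simp only [Finset.mem_range, Finset.mem_Ico]
    omega
  rw [Finset.sum_add_distrib, h, ← Finset.sum_add_distrib, ← Finset.sum_add_distrib]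
  refine Finset.sum_congr rfl fun r hr => ?_
  rw [Finset.sum_range_succ, ← Finset.sum_range_add_sum_Ico _ (Finset.mem_range.1 hr).le]
  ring

/-- The sum of a function over the arm-leg weights of a pair of diagrams, in terms of row ends. -/
theorem sum_weights_eq_rows (Y W : YoungDiagram) {n : ℕ} (hY : Y.colLen 0 ≤ n)
    (hW : W.colLen 0 ≤ n) {f Φ : ℤ → ℝ} (hΦ : ∀ m, Φ (m + 1) - Φ m = f m) :
    ∑ s ∈ Y.cells, f (colEnd Y s.2 - rowEnd W s.1) + ∑ t ∈ W.cells, f (rowEnd Y t.1 - colEnd W t.2)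
      = ∑ r ∈ Finset.range n, (Φ (rowEnd Y r + n) - Φ (1 - n - rowEnd W r))
        - ∑ r ∈ Finset.range n, ∑ r' ∈ Finset.range n, f (rowEnd Y r - rowEnd W r') := by
  rw [sum_colEnd_sub_rowEnd Y W hY hΦ, sum_rowEnd_sub_colEnd Y W hW hΦ]
  have h := sum_Ico_add_sum_Ico n fun r r' => f (rowEnd Y r - rowEnd W r')
  -- The two triangles of pairs of rows count the diagonal twice; the extra copy cancels against
  -- these differences of `Φ`.
  have h2 : ∑ r ∈ Finset.range n, (Φ (rowEnd Y r - rowEnd W r + 1) - Φ (rowEnd Y r - rowEnd W r))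
      = ∑ r ∈ Finset.range n, f (rowEnd Y r - rowEnd W r) :=
    Finset.sum_congr rfl fun r _ => hΦ _
  simp only [Finset.sum_sub_distrib, Finset.sum_add_distrib] at h h2 ⊢
  linarith

/-- Telescoping along rows in both diagrams produces the same double sum over row ends and the same
`Φ` terms as `sum_weights_eq_rows`, with opposite sign. Adding the two identities leaves only
contents, and the cutoff `n` disappears. -/
theorem sum_second_difference_rows (Y W : YoungDiagram) {n : ℕ} (hY : Y.colLen 0 ≤ n)
    (hW : W.colLen 0 ≤ n) {f Φ : ℤ → ℝ} (hΦ : ∀ m, Φ (m + 1) - Φ m = f m) :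
    ∑ s ∈ Y.cells, ∑ t ∈ W.cells, (2 * f (content s - content t)
        - f (content s - content t + 1) - f (content s - content t - 1))
      = ∑ r ∈ Finset.range n, ∑ r' ∈ Finset.range n, f (rowEnd Y r - rowEnd W r')
        - ∑ r ∈ Finset.range n, (Φ (rowEnd Y r + n) - Φ (1 - n - rowEnd W r))
        + ∑ s ∈ Y.cells, f (content s) + ∑ t ∈ W.cells, f (-content t) := by
  have hinner : ∀ k : ℤ, ∑ t ∈ W.cells, (2 * f (k - content t) - f (k - content t + 1)
      - f (k - content t - 1))
      = ∑ r ∈ Finset.range n, (f (k + 1 - rowEnd W r) - f (k - rowEnd W r))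
        - (f (k + n) - f k) := by
    intro k
    have h := sum_content_difference_rows W hW fun c => f (k - c + 1) - f (k - c)
    have h2 := sum_range_sub_int f k n
    have h3 : ∑ r ∈ Finset.range n, (f (k - -(r : ℤ) + 1) - f (k - -(r : ℤ))) = f (k + n) - f k := by
      rw [← h2]
      simp only [sub_neg_eq_add]
    replace h := h.trans (Finset.sum_sub_distrib _ _)
    rw [h3] at h
    refine Eq.trans ?_ (h.trans ?_)
    · refine Finset.sum_congr rfl fun t _ => ?_
      rw [show k - (content t + 1) + 1 = k - content t by ring,
        show k - (content t + 1) = k - content t - 1 by ring]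
      ring
    · congr 1
      refine Finset.sum_congr rfl fun r _ => ?_
      rw [show k - rowEnd W r + 1 = k + 1 - rowEnd W r by ring]
  simp only [hinner]
  rw [Finset.sum_sub_distrib, Finset.sum_comm]
  have h1 : ∀ r, ∑ s ∈ Y.cells, (f (content s + 1 - rowEnd W r) - f (content s - rowEnd W r))
      = ∑ r' ∈ Finset.range n, f (rowEnd Y r' - rowEnd W r)
        - (Φ (1 - rowEnd W r) - Φ (1 - n - rowEnd W r)) := by
    intro r
    rw [sum_content_difference_rows Y hY fun c => f (c - rowEnd W r), Finset.sum_sub_distrib]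
    congr 1
    have h := sum_range_sub_int (fun m => - Φ (1 - m - rowEnd W r)) 0 n
    simp only [zero_add, sub_zero] at h
    rw [show Φ (1 - rowEnd W r) - Φ (1 - n - rowEnd W r)
      = -Φ (1 - n - rowEnd W r) - -Φ (1 - rowEnd W r) by ring, ← h]
    refine Finset.sum_congr rfl fun i _ => ?_
    rw [← hΦ, show 1 - ((i : ℤ) + 1) - rowEnd W r = -(i : ℤ) - rowEnd W r by ring,
      show 1 - (i : ℤ) - rowEnd W r = -(i : ℤ) - rowEnd W r + 1 by ring]
    ring
  have h2 : ∑ s ∈ Y.cells, f (content s + n)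
      = ∑ r ∈ Finset.range n, (Φ (rowEnd Y r + n) - Φ (n - r)) := by
    have h := sum_content_difference_rows Y hY fun c => Φ (c + n)
    simp only [neg_add_eq_sub] at h
    rw [← h]
    refine Finset.sum_congr rfl fun s _ => ?_
    rw [← hΦ, add_right_comm]
  have h3 : ∑ t ∈ W.cells, f (-content t)
      = ∑ r ∈ Finset.range n, (Φ (1 + r) - Φ (1 - rowEnd W r)) := by
    have h := sum_content_difference_rows W hW fun c => - Φ (1 - c)
    have e : ∀ r : ℕ, - Φ (1 - rowEnd W r) - -Φ (1 - -(r : ℤ)) = Φ (1 + r) - Φ (1 - rowEnd W r) := by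
      intro r
      rw [sub_neg_eq_add 1]
      ring
    simp only [e] at h
    rw [← h]
    refine Finset.sum_congr rfl fun s _ => ?_
    rw [← hΦ, show 1 - (content s + 1) = -content s by ring,
      show 1 - content s = -content s + 1 by ring]
    ring
  have h4 : ∑ r ∈ Finset.range n, Φ ((n : ℤ) - r) = ∑ r ∈ Finset.range n, Φ (1 + r) := by
    rw [← Finset.sum_range_reflect]
    refine Finset.sum_congr rfl fun r hr => ?_
    rw [Finset.mem_range] at hr
    congr 1
    omega
  simp only [h1, h3, Finset.sum_sub_distrib, h2]
  rw [Finset.sum_comm, h4]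
  ring

/-- The sum of a function over the arm-leg weights of a pair of diagrams, in terms of contents and
of the principal hooks. -/
theorem sum_weights_eq (Y W : YoungDiagram) (f : ℤ → ℝ) :
    ∑ s ∈ Y.cells, f (colEnd Y s.2 - rowEnd W s.1) + ∑ t ∈ W.cells, f (rowEnd Y t.1 - colEnd W t.2)
      = ∑ s ∈ Y.cells, f (content s) + ∑ t ∈ W.cells, f (-content t)
        - ∑ u ∈ Finset.range (durfee Y), ∑ v ∈ Finset.range (durfee W),
          (f (rowEnd Y u - rowEnd W v) + f (colEnd Y u - colEnd W v)
            - f (rowEnd Y u - colEnd W v) - f (colEnd Y u - rowEnd W v)) := by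
  obtain ⟨n, hY, hW⟩ : ∃ n, Y.colLen 0 ≤ n ∧ W.colLen 0 ≤ n :=
    ⟨max _ _, le_max_left _ _, le_max_right _ _⟩
  obtain ⟨Φ, hΦ⟩ := exists_antidifference f
  have h1 := sum_weights_eq_rows Y W hY hW hΦ
  have h2 := sum_second_difference_rows Y W hY hW hΦ
  -- The same second difference telescoped along principal hooks instead of rows: only Durfee-many
  -- endpoints survive, which is what makes the correction small.
  have h3 : ∑ s ∈ Y.cells, ∑ t ∈ W.cells, (2 * f (content s - content t)
        - f (content s - content t + 1) - f (content s - content t - 1))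
      = ∑ u ∈ Finset.range (durfee Y), ∑ v ∈ Finset.range (durfee W),
          (f (rowEnd Y u - rowEnd W v) + f (colEnd Y u - colEnd W v)
            - f (rowEnd Y u - colEnd W v) - f (colEnd Y u - rowEnd W v)) := by
    have hin : ∀ k : ℤ, ∑ t ∈ W.cells, (2 * f (k - content t) - f (k - content t + 1)
        - f (k - content t - 1))
        = ∑ v ∈ Finset.range (durfee W), ((f (k + 1 - rowEnd W v) - f (k + 1 - colEnd W v))
          - (f (k - rowEnd W v) - f (k - colEnd W v))) := by
      intro k
      have h := sum_content_difference W fun c => f (k - c + 1) - f (k - c)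
      convert h using 1
      · refine Finset.sum_congr rfl fun t _ => ?_
        rw [show k - (content t + 1) + 1 = k - content t by ring,
          show k - (content t + 1) = k - content t - 1 by ring]
        ring
      · refine Finset.sum_congr rfl fun v _ => ?_
        rw [show k - rowEnd W v + 1 = k + 1 - rowEnd W v by ring,
          show k - colEnd W v + 1 = k + 1 - colEnd W v by ring]
        ring
    simp only [hin]
    rw [Finset.sum_comm, Finset.sum_comm (s := Finset.range (durfee Y))]
    refine Finset.sum_congr rfl fun v _ => ?_
    rw [sum_content_difference Y fun k => f (k - rowEnd W v) - f (k - colEnd W v)]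
    exact Finset.sum_congr rfl fun u _ => by ring
  rw [← h3]
  linarith

/-! ### Cauchy determinants -/

open Polynomial in
theorem eval_matrix_eq_vandermonde_mul {n : ℕ} (v : Fin n → ℂ) (p : Fin n → ℂ[X])
    (h : ∀ i, (p i).natDegree < n) :
    Matrix.of (fun i j => (p j).eval (v i))
      = Matrix.vandermonde v * Matrix.of fun i j : Fin n => (p j).coeff i := by
  ext i j
  rw [Matrix.of_apply, Polynomial.eval_eq_sum_range' (h j), Matrix.mul_apply,
    ← Fin.sum_univ_eq_sum_range (fun k => (p j).coeff k * v i ^ k)]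
  simp [Matrix.vandermonde_apply, mul_comm]

/-- Logarithm of the modulus, with value `0` at `0`. -/
noncomputable def logNorm (z : ℂ) : ℝ := Real.log ‖z‖

theorem logNorm_zero : logNorm 0 = 0 := by simp [logNorm]

theorem logNorm_neg (z : ℂ) : logNorm (-z) = logNorm z := by simp [logNorm]

theorem logNorm_sub_comm (z w : ℂ) : logNorm (z - w) = logNorm (w - z) := by
  rw [← logNorm_neg, neg_sub]

theorem logNorm_mul {z w : ℂ} (hz : z ≠ 0) (hw : w ≠ 0) :
    logNorm (z * w) = logNorm z + logNorm w := by
  rw [logNorm, norm_mul, Real.log_mul (norm_ne_zero_iff.2 hz) (norm_ne_zero_iff.2 hw)]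
  rfl

theorem logNorm_prod {ι : Type*} (s : Finset ι) (F : ι → ℂ) (h : ∀ i ∈ s, F i ≠ 0) :
    logNorm (∏ i ∈ s, F i) = ∑ i ∈ s, logNorm (F i) := by
  rw [logNorm, norm_prod, Real.log_prod fun i hi => norm_ne_zero_iff.2 (h i hi)]
  rfl

theorem sum_logNorm_sub {n : ℕ} {v : Fin n → ℂ} (hv : Function.Injective v) :
    ∑ i, ∑ j, logNorm (v i - v j) = 2 * logNorm (Matrix.vandermonde v).det := by
  have h := Finset.sum_sum_Ioi_add_eq_sum_sum_off_diag fun i j => logNorm (v i - v j)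
  have h1 : ∀ i, ∑ j ∈ ({i} : Finset (Fin n))ᶜ, logNorm (v j - v i)
      = ∑ j, logNorm (v j - v i) := by
    intro i
    refine Finset.sum_subset (Finset.subset_univ _) fun j _ hj => ?_
    simp only [Finset.mem_compl, Finset.mem_singleton, not_not] at hj
    rw [hj, sub_self, logNorm_zero]
  rw [Finset.sum_comm, ← Finset.sum_congr rfl fun i _ => h1 i, ← h, Matrix.det_vandermonde,
    logNorm_prod, Finset.mul_sum]
  · refine Finset.sum_congr rfl fun i _ => ?_
    rw [logNorm_prod, Finset.mul_sum]
    · refine Finset.sum_congr rfl fun j _ => ?_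
      rw [logNorm_sub_comm (v i)]
      ring
    · intro j hj
      exact sub_ne_zero.2 (hv.ne (Finset.mem_Ioi.1 hj).ne')
  · intro i _
    refine Finset.prod_ne_zero_iff.2 fun j hj => ?_
    exact sub_ne_zero.2 (hv.ne (Finset.mem_Ioi.1 hj).ne')

-- Evaluate the polynomials `∏ k ≠ j, (X - b k)` at two sets of nodes. At the `a i` they give the
-- Cauchy matrix with rescaled rows, at the `b i` a diagonal matrix. Both equal a Vandermonde matrix
-- times the same coefficient matrix, whose determinant `c` is eliminated.
open Polynomial in
theorem sum_logNorm_cauchy_fin {n : ℕ} {a b : Fin n → ℂ} (ha : Function.Injective a)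
    (hb : Function.Injective b) (hab : ∀ i j, a i ≠ b j) :
    ∑ i, ∑ j, (logNorm (a i - a j) + logNorm (b i - b j) - 2 * logNorm (a i - b j))
      = 2 * logNorm (Matrix.of fun i j => (a i - b j)⁻¹).det := by
  set p : Fin n → ℂ[X] := fun j => ∏ k ∈ Finset.univ.erase j, (X - C (b k)) with hp
  have hdeg : ∀ j, (p j).natDegree < n := by
    intro j
    have hn : 0 < n := j.pos
    rw [hp]
    simp only
    rw [natDegree_prod_of_monic _ _ fun k _ => monic_X_sub_C _]
    simp [hn]
  have hVa := Matrix.det_vandermonde_ne_zero_iff.2 ha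
  have hVb := Matrix.det_vandermonde_ne_zero_iff.2 hb
  have hab' : ∀ i j, a i - b j ≠ 0 := fun i j => sub_ne_zero.2 (hab i j)
  have hA := congrArg Matrix.det (eval_matrix_eq_vandermonde_mul a p hdeg)
  have hB := congrArg Matrix.det (eval_matrix_eq_vandermonde_mul b p hdeg)
  rw [Matrix.det_mul] at hA hB
  set c := (Matrix.of fun i j : Fin n => (p j).coeff i).det
  have hA' : (Matrix.of fun i j => (p j).eval (a i)).det
      = (∏ i, ∏ k, (a i - b k)) * (Matrix.of fun i j => (a i - b j)⁻¹).det := by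
    rw [← Matrix.det_mul_column]
    congr 1
    ext i j
    simp only [Matrix.of_apply, hp, eval_prod, eval_sub, eval_X, eval_C]
    rw [← Finset.mul_prod_erase _ _ (Finset.mem_univ j), mul_right_comm,
      mul_inv_cancel₀ (hab' i j), one_mul]
  have hB' : (Matrix.of fun i j => (p j).eval (b i)).det
      = ∏ i, ∏ k ∈ Finset.univ.erase i, (b i - b k) := by
    have : Matrix.of (fun i j => (p j).eval (b i))
        = Matrix.diagonal fun i => ∏ k ∈ Finset.univ.erase i, (b i - b k) := by
      ext i j
      simp only [Matrix.of_apply, hp, eval_prod, eval_sub, eval_X, eval_C]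
      rcases eq_or_ne i j with rfl | hij
      · rw [Matrix.diagonal_apply_eq]
      · rw [Matrix.diagonal_apply_ne _ hij]
        exact Finset.prod_eq_zero (Finset.mem_erase.2 ⟨hij, Finset.mem_univ i⟩) (sub_self _)
    rw [this, Matrix.det_diagonal]
  have hbne : ∀ i, ∀ k ∈ Finset.univ.erase i, b i - b k ≠ 0 := fun i k hk =>
    sub_ne_zero.2 (hb.ne (Finset.ne_of_mem_erase hk).symm)
  have hBne : ∏ i, ∏ k ∈ Finset.univ.erase i, (b i - b k) ≠ 0 :=
    Finset.prod_ne_zero_iff.2 fun i _ => Finset.prod_ne_zero_iff.2 (hbne i)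
  have hPne : ∏ i, ∏ k, (a i - b k) ≠ 0 :=
    Finset.prod_ne_zero_iff.2 fun i _ => Finset.prod_ne_zero_iff.2 fun k _ => hab' i k
  rw [hB'] at hB
  have hc : c ≠ 0 := fun h => hBne (by rw [hB, h, mul_zero])
  rw [hA'] at hA
  have hC : (Matrix.of fun i j => (a i - b j)⁻¹).det ≠ 0 := fun h => by
    rw [h, mul_zero] at hA
    exact mul_ne_zero hVa hc hA.symm
  replace hA := congrArg logNorm hA
  replace hB := congrArg logNorm hB
  rw [logNorm_mul hPne hC, logNorm_mul hVa hc,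
    logNorm_prod _ _ fun i _ => Finset.prod_ne_zero_iff.2 fun k _ => hab' i k] at hA
  rw [logNorm_mul hVb hc,
    logNorm_prod _ _ fun i _ => Finset.prod_ne_zero_iff.2 (hbne i)] at hB
  have hA2 : ∑ i, logNorm (∏ k, (a i - b k)) = ∑ i, ∑ k, logNorm (a i - b k) :=
    Finset.sum_congr rfl fun i _ => logNorm_prod _ _ fun k _ => hab' i k
  have hB2 : ∑ i, logNorm (∏ k ∈ Finset.univ.erase i, (b i - b k))
      = ∑ i, ∑ k, logNorm (b i - b k) := by
    refine Finset.sum_congr rfl fun i _ => ?_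
    rw [logNorm_prod _ _ (hbne i), ← Finset.add_sum_erase _ _ (Finset.mem_univ i), sub_self,
      logNorm_zero, zero_add]
  have h1 := sum_logNorm_sub ha
  have h2 := sum_logNorm_sub hb
  simp only [Finset.sum_sub_distrib, Finset.sum_add_distrib, ← Finset.mul_sum]
  linarith

/-- Leibniz expansion with `n! ≤ n ^ n`. The condition `1 ≤ M` makes the right side nonnegative,
which covers a vanishing determinant, where `logNorm` is `0`. -/
theorem logNorm_det_le {n : ℕ} {A : Matrix (Fin n) (Fin n) ℂ} {M : ℝ} (hM : 1 ≤ M)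
    (hA : ∀ i j, ‖A i j‖ ≤ M) : logNorm A.det ≤ n * Real.log (n * M) := by
  rcases eq_or_ne n 0 with rfl | hn
  · simp [logNorm]
  have hdet := Matrix.det_le (abv := NormedField.toAbsoluteValue ℂ) (x := M) (A := A)
    fun i j => hA i j
  rw [Fintype.card_fin, nsmul_eq_mul] at hdet
  replace hdet : ‖A.det‖ ≤ _ := hdet
  rw [logNorm]
  rcases (norm_nonneg A.det).eq_or_lt with h0 | h0
  · rw [← h0, Real.log_zero]
    have : (1 : ℝ) ≤ n := by exact_mod_cast Nat.one_le_iff_ne_zero.2 hn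
    exact mul_nonneg (by positivity) (Real.log_nonneg (by nlinarith))
  · rw [← Real.log_pow]
    refine Real.log_le_log h0 (hdet.trans ?_)
    rw [mul_pow]
    gcongr
    exact_mod_cast Nat.factorial_le_pow n

theorem sum_logNorm_cauchy_le {ι : Type*} [Fintype ι] {a b : ι → ℂ} (ha : Function.Injective a)
    (hb : Function.Injective b) {M : ℝ} (hM : 1 ≤ M) (hab : ∀ i j, a i ≠ b j)
    (hle : ∀ i j, ‖(a i - b j)⁻¹‖ ≤ M) :
    ∑ i, ∑ j, (logNorm (a i - a j) + logNorm (b i - b j) - 2 * logNorm (a i - b j))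
      ≤ 2 * (Fintype.card ι * Real.log (Fintype.card ι * M)) := by
  let e := (Fintype.equivFin ι).symm
  have h := sum_logNorm_cauchy_fin (ha.comp e.injective) (hb.comp e.injective)
    fun i j => hab (e i) (e j)
  have h1 : ∑ i, ∑ j, (logNorm (a i - a j) + logNorm (b i - b j) - 2 * logNorm (a i - b j))
      = ∑ i, ∑ j, (logNorm ((a ∘ e) i - (a ∘ e) j) + logNorm ((b ∘ e) i - (b ∘ e) j)
        - 2 * logNorm ((a ∘ e) i - (b ∘ e) j)) := by
    rw [← e.sum_comp]
    refine Finset.sum_congr rfl fun i _ => ?_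
    rw [← e.sum_comp]
    rfl
  rw [h1, h]
  refine mul_le_mul_of_nonneg_left ?_ zero_le_two
  exact logNorm_det_le hM fun i j => hle _ _

/-! ### Counting boxes and diagrams -/

theorem succ_mul_succ_le_card {Y : YoungDiagram} {u : ℕ} (h : (u, u) ∈ Y.cells) :
    (u + 1) * (u + 1) ≤ Y.card := by
  have hsub : Finset.range (u + 1) ×ˢ Finset.range (u + 1) ⊆ Y.cells := by
    rintro ⟨r, c⟩ hrc
    simp only [Finset.mem_product, Finset.mem_range] at hrc
    exact mem_cells_of_le h (by omega) (by omega)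
  simpa using Finset.card_le_card hsub

theorem lt_sqrt_succ_of_diag_mem {Y : YoungDiagram} {u k : ℕ} (h : (u, u) ∈ Y.cells)
    (hk : Y.card ≤ k) : u < Nat.sqrt k + 1 := by
  have := Nat.le_sqrt.2 ((succ_mul_succ_le_card h).trans hk)
  omega

theorem durfee_le {Y : YoungDiagram} {k : ℕ} (hk : Y.card ≤ k) : durfee Y ≤ Nat.sqrt k + 1 := by
  rcases Nat.eq_zero_or_pos (durfee Y) with h | h
  · omega
  · have := lt_sqrt_succ_of_diag_mem (diag_mem (Y := Y) (u := durfee Y - 1) (by omega)) hk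
    omega

theorem min_lt_sqrt_succ {Y : YoungDiagram} {k : ℕ} (hk : Y.card ≤ k) {r c : ℕ}
    (h : (r, c) ∈ Y.cells) : min r c < Nat.sqrt k + 1 :=
  lt_sqrt_succ_of_diag_mem (mem_cells_of_le h (min_le_left _ _) (min_le_right _ _)) hk

/-- On a diagonal a box is determined by its smaller coordinate `u`, and a box with smaller
coordinate `u` forces a square of side `u + 1` inside `Y`. -/
theorem card_content_eq_le {Y : YoungDiagram} {k : ℕ} (hk : Y.card ≤ k) (m : ℤ) :
    (Y.cells.filter fun s => content s = m).card ≤ Nat.sqrt k + 1 := by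
  rw [← Finset.card_range (Nat.sqrt k + 1)]
  refine Finset.card_le_card_of_injOn (fun s => min s.1 s.2) ?_ ?_
  · rintro ⟨r, c⟩ h
    simp only [Finset.coe_filter, Set.mem_ofPred_eq] at h
    simpa using min_lt_sqrt_succ hk h.1
  · rintro ⟨r, c⟩ h ⟨r', c'⟩ h' e
    have h1 := (Finset.mem_filter.1 (Finset.mem_coe.1 h)).2
    have h2 := (Finset.mem_filter.1 (Finset.mem_coe.1 h')).2
    simp only [content] at h1 h2 e
    rw [Prod.mk.injEq]
    omega

theorem card_content_mem_le {Y : YoungDiagram} {k : ℕ} (hk : Y.card ≤ k) (S : Finset ℤ) :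
    (Y.cells.filter fun s => content s ∈ S).card ≤ S.card * (Nat.sqrt k + 1) := by
  classical
  have h : (Y.cells.filter fun s => content s ∈ S)
      = S.biUnion fun m => Y.cells.filter fun s => content s = m := by
    ext s
    simp only [Finset.mem_filter, Finset.mem_biUnion]
    constructor
    · rintro ⟨h1, h2⟩
      exact ⟨_, h2, h1, rfl⟩
    · rintro ⟨m, hm, h1, rfl⟩
      exact ⟨h1, hm⟩
  rw [h]
  exact Finset.card_biUnion_le_card_mul _ _ _ fun m _ => card_content_eq_le hk m

theorem rowLen_le_card (Y : YoungDiagram) (i : ℕ) : Y.rowLen i ≤ Y.card := by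
  rw [YoungDiagram.rowLen_eq_card]
  exact Finset.card_le_card (Finset.filter_subset _ _)

theorem colLen_le_card (Y : YoungDiagram) (j : ℕ) : Y.colLen j ≤ Y.card := by
  rw [YoungDiagram.colLen_eq_card]
  exact Finset.card_le_card (Finset.filter_subset _ _)

/-- Every box has a coordinate at most `√k`, so the first `√k + 1` rows and columns cover the
diagram. This gives the subexponential count of tuples. -/
theorem eq_of_rowLen_colLen_eq {Y W : YoungDiagram} {k : ℕ} (hY : Y.card ≤ k) (hW : W.card ≤ k)
    (hr : ∀ r < Nat.sqrt k + 1, Y.rowLen r = W.rowLen r)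
    (hc : ∀ c < Nat.sqrt k + 1, Y.colLen c = W.colLen c) : Y = W := by
  have key : ∀ {Y W : YoungDiagram}, Y.card ≤ k → (∀ r < Nat.sqrt k + 1, Y.rowLen r = W.rowLen r) →
      (∀ c < Nat.sqrt k + 1, Y.colLen c = W.colLen c) → Y.cells ⊆ W.cells := by
    rintro Y W hY hr hc ⟨r, c⟩ h
    rcases min_lt_iff.1 (min_lt_sqrt_succ hY h) with h1 | h1
    · rw [mem_cells_iff_lt_rowLen, ← hr r h1]
      exact mem_cells_iff_lt_rowLen.1 h
    · rw [mem_cells_iff_lt_colLen, ← hc c h1]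
      exact mem_cells_iff_lt_colLen.1 h
  exact YoungDiagram.ext (Finset.Subset.antisymm (key hY hr hc)
    (key hW (fun r h => (hr r h).symm) fun c h => (hc c h).symm))

theorem mem_youngTuples {N k : ℕ} {Y : Fin N → YoungDiagram} :
    Y ∈ youngTuples N k ↔ ∑ i, (Y i).card = k := by
  simp [youngTuples]

theorem card_le_of_mem_youngTuples {N k : ℕ} {Y : Fin N → YoungDiagram} (h : Y ∈ youngTuples N k)
    (i : Fin N) : (Y i).card ≤ k := by
  rw [← mem_youngTuples.1 h]
  exact Finset.single_le_sum (f := fun i => (Y i).card) (fun _ _ => Nat.zero_le _)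
    (Finset.mem_univ i)

theorem card_youngTuples_le (N k : ℕ) :
    (youngTuples N k).card ≤ (k + 1) ^ (2 * N * (Nat.sqrt k + 1)) := by
  set s := Nat.sqrt k + 1 with hs
  have hcard : (Finset.univ : Finset (Fin N → (Fin s → Fin (k + 1)) × (Fin s → Fin (k + 1)))).card
      = (k + 1) ^ (2 * N * s) := by
    simp only [Finset.card_univ, Fintype.card_pi_const, Fintype.card_prod, Fintype.card_fin]
    rw [← pow_add, ← pow_mul]
    congr 1
    ring
  rw [← hcard]
  refine Finset.card_le_card_of_injOn (fun Y i => (fun r => Fin.ofNat (k + 1) ((Y i).rowLen r),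
    fun c => Fin.ofNat (k + 1) ((Y i).colLen c))) (fun _ _ => Finset.mem_coe.2 (Finset.mem_univ _)) ?_
  intro Y hY W hW h
  funext i
  have hYi := card_le_of_mem_youngTuples hY i
  have hWi := card_le_of_mem_youngTuples hW i
  have hi := congrFun h i
  simp only [Prod.mk.injEq] at hi
  refine eq_of_rowLen_colLen_eq hYi hWi (fun r hr => ?_) fun c hc => ?_
  · have h1 := congrArg Fin.val (congrFun hi.1 ⟨r, hr⟩)
    simp only [Fin.ofNat] at h1
    rwa [Nat.mod_eq_of_lt (Nat.lt_succ_of_le ((rowLen_le_card _ _).trans hYi)),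
      Nat.mod_eq_of_lt (Nat.lt_succ_of_le ((rowLen_le_card _ _).trans hWi))] at h1
  · have h1 := congrArg Fin.val (congrFun hi.2 ⟨c, hc⟩)
    simp only [Fin.ofNat] at h1
    rwa [Nat.mod_eq_of_lt (Nat.lt_succ_of_le ((colLen_le_card _ _).trans hYi)),
      Nat.mod_eq_of_lt (Nat.lt_succ_of_le ((colLen_le_card _ _).trans hWi))] at h1

/-! ### Bound on a single term of the instanton sum -/

theorem weightE_eq {ε : ℂ} (z : ℂ) (Y W : YoungDiagram) (s : ℕ × ℕ) :
    weightE ε (-ε) (ε * z) Y W s = ε * (z + ((colEnd Y s.2 - rowEnd W s.1 : ℤ) : ℂ)) := by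
  unfold weightE legLength armLength colEnd rowEnd
  push_cast
  ring

/-- Equality unless `z = 0`, where the left side is `1 / 0 = 0` while `logNorm 0 = 0`. Vanishing
weights thus need no separate treatment. -/
theorem norm_one_div_mul_le {ε : ℂ} (z : ℂ) : ‖1 / (ε * z)‖ ≤ ‖ε‖⁻¹ * Real.exp (-logNorm z) := by
  rw [one_div, mul_inv, norm_mul, norm_inv, norm_inv]
  refine mul_le_mul_of_nonneg_left ?_ (by positivity)
  rcases eq_or_ne z 0 with rfl | hz
  · simpa using (Real.exp_pos _).le
  · rw [logNorm, Real.exp_neg, Real.exp_log (norm_pos_iff.2 hz)]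

/-- The exponent by which the vector multiplet contribution of a pair of diagrams differs from a
product over the contents of the boxes. -/
noncomputable def hookInteraction (z : ℂ) (Y W : YoungDiagram) : ℝ :=
  ∑ u ∈ Finset.range (durfee Y), ∑ v ∈ Finset.range (durfee W),
    (logNorm (z + (rowEnd Y u - rowEnd W v : ℤ)) + logNorm (z + (colEnd Y u - colEnd W v : ℤ))
      - logNorm (z + (rowEnd Y u - colEnd W v : ℤ)) - logNorm (z + (colEnd Y u - rowEnd W v : ℤ)))

theorem prod_norm_one_div_weight_le {ε : ℂ} (z : ℂ) (Y W : YoungDiagram) :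
    (∏ s ∈ Y.cells, ‖1 / weightE ε (-ε) (ε * z) Y W s‖)
      * ∏ t ∈ W.cells, ‖1 / (ε + -ε - weightE ε (-ε) (ε * -z) W Y t)‖
    ≤ (∏ s ∈ Y.cells, ‖ε‖⁻¹ * Real.exp (-logNorm (z + content s)))
      * (∏ t ∈ W.cells, ‖ε‖⁻¹ * Real.exp (-logNorm (-z + content t)))
      * Real.exp (hookInteraction z Y W) := by
  have h1 : ∏ s ∈ Y.cells, ‖1 / weightE ε (-ε) (ε * z) Y W s‖ ≤ ∏ s ∈ Y.cells,
      ‖ε‖⁻¹ * Real.exp (-logNorm (z + (colEnd Y s.2 - rowEnd W s.1 : ℤ))) := by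
    refine Finset.prod_le_prod (fun _ _ => norm_nonneg _) fun s _ => ?_
    rw [weightE_eq]
    exact norm_one_div_mul_le _
  have h2 : ∏ t ∈ W.cells, ‖1 / (ε + -ε - weightE ε (-ε) (ε * -z) W Y t)‖ ≤ ∏ t ∈ W.cells,
      ‖ε‖⁻¹ * Real.exp (-logNorm (z + (rowEnd Y t.1 - colEnd W t.2 : ℤ))) := by
    refine Finset.prod_le_prod (fun _ _ => norm_nonneg _) fun t _ => ?_
    rw [weightE_eq, show ε + -ε - ε * (-z + ((colEnd W t.2 - rowEnd Y t.1 : ℤ) : ℂ))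
      = ε * (z + (rowEnd Y t.1 - colEnd W t.2 : ℤ)) by push_cast; ring]
    exact norm_one_div_mul_le _
  refine (mul_le_mul h1 h2 (Finset.prod_nonneg fun _ _ => norm_nonneg _)
    (Finset.prod_nonneg fun _ _ => by positivity)).trans (le_of_eq ?_)
  simp only [Finset.prod_mul_distrib, ← Real.exp_sum, Finset.prod_const, Finset.sum_neg_distrib]
  have h := sum_weights_eq Y W fun n => logNorm (z + n)
  have h3 : ∀ t : ℕ × ℕ, logNorm (-z + content t) = logNorm (z + ((-content t : ℤ) : ℂ)) := by
    intro t
    rw [← logNorm_neg]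
    push_cast
    ring_nf
  simp only [h3]
  rw [mul_mul_mul_comm, mul_mul_mul_comm _ (Real.exp _), mul_assoc (_ * _) (_ * _) (Real.exp _)]
  congr 1
  rw [← Real.exp_add, ← Real.exp_add, ← Real.exp_add]
  congr 1
  unfold hookInteraction
  linarith

/-- Bound on the contribution of a box of content `c` of the `i`-th diagram. -/
noncomputable def boxBound {N Nf : ℕ} (ε : ℂ) (α : Fin N → ℂ) (m : Fin Nf → ℂ) (i : Fin N)
    (c : ℤ) : ℝ :=
  (∏ j, (‖ε‖⁻¹ * Real.exp (-logNorm (α i - α j + c))) ^ 2) * ∏ r, ‖ε * α i - ε * c + m r‖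

theorem boxBound_nonneg {N Nf : ℕ} (ε : ℂ) (α : Fin N → ℂ) (m : Fin Nf → ℂ) (i : Fin N) (c : ℤ) :
    0 ≤ boxBound ε α m i c :=
  mul_nonneg (Finset.prod_nonneg fun _ _ => by positivity)
    (Finset.prod_nonneg fun _ _ => norm_nonneg _)

theorem norm_zVect_le {N : ℕ} (ε : ℂ) (α : Fin N → ℂ) (Y : Fin N → YoungDiagram) :
    ‖zVect ε (-ε) (fun i => ε * α i) Y‖
      ≤ (∏ i, ∏ s ∈ (Y i).cells, ∏ j,
          (‖ε‖⁻¹ * Real.exp (-logNorm (α i - α j + content s))) ^ 2)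
        * Real.exp (∑ i, ∑ j, hookInteraction (α i - α j) (Y i) (Y j)) := by
  set P : Fin N → Fin N → ℝ := fun i j =>
    ∏ s ∈ (Y i).cells, ‖ε‖⁻¹ * Real.exp (-logNorm (α i - α j + content s)) with hP
  have h1 : ‖zVect ε (-ε) (fun i => ε * α i) Y‖
      ≤ ∏ i, ∏ j, P i j * P j i * Real.exp (hookInteraction (α i - α j) (Y i) (Y j)) := by
    unfold zVect
    simp only [norm_prod, norm_mul]
    refine Finset.prod_le_prod (fun _ _ => Finset.prod_nonneg fun _ _ => by positivity)
      fun i _ => Finset.prod_le_prod (fun _ _ => by positivity) fun j _ => ?_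
    have h := prod_norm_one_div_weight_le (ε := ε) (α i - α j) (Y i) (Y j)
    rw [neg_sub, mul_sub, mul_sub] at h
    exact h
  refine h1.trans (le_of_eq ?_)
  -- The ordered pairs `(i, j)` and `(j, i)` each supply a factor `P i j`, whence the square.
  have h2 : ∏ i, ∏ s ∈ (Y i).cells, ∏ j,
      (‖ε‖⁻¹ * Real.exp (-logNorm (α i - α j + content s))) ^ 2 = ∏ i, ∏ j, P i j * P i j := by
    refine Finset.prod_congr rfl fun i _ => ?_
    rw [Finset.prod_comm]
    refine Finset.prod_congr rfl fun j _ => ?_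
    rw [hP, ← Finset.prod_mul_distrib]
    exact Finset.prod_congr rfl fun s _ => sq _
  rw [h2]
  simp only [Finset.prod_mul_distrib, Real.exp_sum]
  rw [Finset.prod_comm (f := fun i j => P j i)]

theorem norm_term_le {N Nf : ℕ} (ε : ℂ) (α : Fin N → ℂ) (m : Fin Nf → ℂ)
    (Y : Fin N → YoungDiagram) :
    ‖zVect ε (-ε) (fun i => ε * α i) Y * ∏ r, zMatter ε (-ε) (fun i => ε * α i) Y (m r)‖
      ≤ (∏ i, ∏ s ∈ (Y i).cells, boxBound ε α m i (content s))
        * Real.exp (∑ i, ∑ j, hookInteraction (α i - α j) (Y i) (Y j)) := by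
  have hm : ‖∏ r, zMatter ε (-ε) (fun i => ε * α i) Y (m r)‖
      = ∏ i, ∏ s ∈ (Y i).cells, ∏ r, ‖ε * α i - ε * content s + m r‖ := by
    unfold zMatter
    simp only [norm_prod]
    rw [Finset.prod_comm]
    refine Finset.prod_congr rfl fun i _ => ?_
    rw [Finset.prod_comm]
    refine Finset.prod_congr rfl fun s _ => Finset.prod_congr rfl fun r _ => ?_
    congr 1
    unfold weightPhi content
    push_cast
    ring
  rw [norm_mul, hm]
  refine (mul_le_mul_of_nonneg_right (norm_zVect_le ε α Y) (Finset.prod_nonneg fun _ _ =>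
    Finset.prod_nonneg fun _ _ => Finset.prod_nonneg fun _ _ => norm_nonneg _)).trans
      (le_of_eq ?_)
  simp only [boxBound, Finset.prod_mul_distrib]
  ring

theorem one_le_rowEnd {Y : YoungDiagram} {u : ℕ} (h : u < durfee Y) : 1 ≤ rowEnd Y u := by
  have := mem_cells_iff_lt_rowLen.1 (diag_mem h)
  unfold rowEnd
  omega

theorem colEnd_le_zero {Y : YoungDiagram} {u : ℕ} (h : u < durfee Y) : colEnd Y u ≤ 0 := by
  have := mem_cells_iff_lt_colLen.1 (diag_mem h)
  unfold colEnd
  omega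

theorem sum_hookInteraction_le {N : ℕ} {α : Fin N → ℂ}
    (hgen : ∀ i j, i ≠ j → ∀ n : ℤ, α i - α j ≠ n) {M : ℝ} (hM1 : 1 ≤ M)
    (hM : ∀ i j, ∀ n : ℤ, ‖(α i - α j + n)⁻¹‖ ≤ M) (Y : Fin N → YoungDiagram) :
    ∑ i, ∑ j, hookInteraction (α i - α j) (Y i) (Y j)
      ≤ 2 * ((∑ i, durfee (Y i) : ℕ) * Real.log ((∑ i, durfee (Y i) : ℕ) * M)) := by
  -- The Cauchy nodes are the two ends of all principal hooks of all diagrams, shifted by `α i`.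
  -- Genericity separates different `i`; within one diagram row ends are positive and column ends
  -- are not.
  let A : (Σ i, Fin (durfee (Y i))) → ℂ := fun p => α p.1 + (rowEnd (Y p.1) p.2 : ℤ)
  let B : (Σ i, Fin (durfee (Y i))) → ℂ := fun p => α p.1 + (colEnd (Y p.1) p.2 : ℤ)
  have hsep : ∀ i j (x y : ℤ), α i + x = α j + y → i = j ∧ x = y := by
    intro i j x y h
    by_cases hij : i = j
    · subst hij
      exact ⟨rfl, by exact_mod_cast add_left_cancel h⟩
    · refine absurd ?_ (hgen i j hij (y - x))
      push_cast
      linear_combination h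
  have hA : Function.Injective A := by
    rintro ⟨i, u⟩ ⟨j, v⟩ h
    obtain ⟨h1, h2⟩ := hsep _ _ _ _ h
    simp only at h1
    subst h1
    rw [show u = v from Fin.ext ((rowEnd_strictAnti _).injective h2)]
  have hB : Function.Injective B := by
    rintro ⟨i, u⟩ ⟨j, v⟩ h
    obtain ⟨h1, h2⟩ := hsep _ _ _ _ h
    simp only at h1
    subst h1
    rw [show u = v from Fin.ext ((colEnd_strictMono _).injective h2)]
  have hAB : ∀ p q, A p ≠ B q := by
    rintro ⟨i, u⟩ ⟨j, v⟩ h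
    have h1 := (hsep _ _ _ _ h).2
    have h2 := one_le_rowEnd u.2
    have h3 := colEnd_le_zero v.2
    simp only at h1
    omega
  have hle : ∀ p q, ‖(A p - B q)⁻¹‖ ≤ M := by
    intro p q
    have h := hM p.1 q.1 (rowEnd (Y p.1) p.2 - colEnd (Y q.1) q.2)
    rw [show A p - B q = α p.1 - α q.1 + ((rowEnd (Y p.1) p.2 - colEnd (Y q.1) q.2 : ℤ) : ℂ) by
      simp only [A, B]; push_cast; ring]
    exact h
  have h := sum_logNorm_cauchy_le hA hB hM1 hAB hle
  rw [Fintype.card_sigma] at h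
  simp only [Fintype.card_fin] at h
  refine le_trans (le_of_eq ?_) h
  have hsum : ∑ i, ∑ j, hookInteraction (α i - α j) (Y i) (Y j)
      = ∑ p, ∑ q, (logNorm (A p - A q) + logNorm (B p - B q) - logNorm (A p - B q)
        - logNorm (B p - A q)) := by
    rw [Fintype.sum_sigma]
    refine Finset.sum_congr rfl fun i _ => ?_
    simp only [Fintype.sum_sigma]
    rw [Finset.sum_comm]
    refine Finset.sum_congr rfl fun j _ => ?_
    unfold hookInteraction
    rw [← Fin.sum_univ_eq_sum_range (fun u => ∑ v ∈ Finset.range (durfee (Y j)), _)]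
    refine Finset.sum_congr rfl fun u _ => ?_
    rw [← Fin.sum_univ_eq_sum_range (fun v => _)]
    refine Finset.sum_congr rfl fun v _ => ?_
    simp only [A, B]
    push_cast
    simp only [add_sub_add_comm]
  have hcomm : ∑ p, ∑ q, logNorm (B p - A q) = ∑ p, ∑ q, logNorm (A p - B q) := by
    rw [Finset.sum_comm]
    exact Finset.sum_congr rfl fun p _ => Finset.sum_congr rfl fun q _ => logNorm_sub_comm _ _
  rw [hsum]
  simp only [Finset.sum_sub_distrib, Finset.sum_add_distrib, ← Finset.mul_sum, hcomm]
  ring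

/-! ### Growth of the coefficients -/

open Filter Topology

theorem tendsto_inv_norm_intCast :
    Tendsto (fun c : ℤ => ‖(c : ℂ)‖⁻¹) cofinite (𝓝 0) := by
  refine tendsto_inv_atTop_zero.comp ?_
  simp only [Complex.norm_intCast]
  exact (tendsto_norm_cocompact_atTop (E := ℝ)).comp Int.tendsto_coe_cofinite

theorem eventually_intCast_ne_zero : ∀ᶠ c : ℤ in cofinite, (c : ℂ) ≠ 0 := by
  simp only [ne_eq, Int.cast_eq_zero]
  exact (Set.finite_singleton (0 : ℤ)).eventually_cofinite_notMem

theorem tendsto_norm_linear_div (w z : ℂ) :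
    Tendsto (fun c : ℤ => ‖w * c + z‖ * ‖(c : ℂ)‖⁻¹) cofinite (𝓝 ‖w‖) := by
  have h : Tendsto (fun c : ℤ => w + z * (c : ℂ)⁻¹) cofinite (𝓝 (w + z * 0)) := by
    refine tendsto_const_nhds.add (tendsto_const_nhds.mul ?_)
    rw [tendsto_zero_iff_norm_tendsto_zero]
    simpa only [norm_inv] using tendsto_inv_norm_intCast
  rw [mul_zero, add_zero] at h
  refine h.norm.congr' ?_
  filter_upwards [eventually_intCast_ne_zero] with c hc
  rw [← norm_inv, ← norm_mul, add_mul, mul_assoc, mul_inv_cancel₀ hc, mul_one]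

/-- There are `2N` linear factors in `c` below and `Nf` above, all with leading coefficient of
modulus `‖ε‖`. The convention `0 ^ 0 = 1` lets one formula give both limits, `1` and `0`. -/
theorem tendsto_boxBound {N Nf : ℕ} {ε : ℂ} (hε : ε ≠ 0) (α : Fin N → ℂ) (m : Fin Nf → ℂ)
    (hN : Nf ≤ 2 * N) (i : Fin N) :
    Tendsto (boxBound ε α m i) cofinite (𝓝 (0 ^ (2 * N - Nf))) := by
  have hα : ∀ j, Tendsto (fun c : ℤ => ‖α i - α j + c‖ * ‖(c : ℂ)‖⁻¹) cofinite (𝓝 1) := by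
    intro j
    have h := tendsto_norm_linear_div 1 (α i - α j)
    simpa only [one_mul, norm_one, add_comm (_ : ℂ) (α i - α j)] using h
  have hm : ∀ r, Tendsto (fun c : ℤ => ‖ε * α i - ε * c + m r‖ * ‖(c : ℂ)‖⁻¹) cofinite
      (𝓝 ‖ε‖) := by
    intro r
    have h := tendsto_norm_linear_div (-ε) (ε * α i + m r)
    rw [norm_neg] at h
    refine h.congr fun c => ?_
    rw [show -ε * c + (ε * α i + m r) = ε * α i - ε * c + m r by ring]
  have hε' : ‖ε‖ ≠ 0 := norm_ne_zero_iff.2 hε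
  have hlim : Tendsto (fun c : ℤ => ((∏ j, ((‖ε‖ * (‖α i - α j + c‖ * ‖(c : ℂ)‖⁻¹))⁻¹) ^ 2)
      * ∏ r, ‖ε * α i - ε * c + m r‖ * ‖(c : ℂ)‖⁻¹) * ‖(c : ℂ)‖⁻¹ ^ (2 * N - Nf)) cofinite
      (𝓝 (((∏ _j : Fin N, ((‖ε‖ * 1)⁻¹) ^ 2) * ∏ _r : Fin Nf, ‖ε‖) * 0 ^ (2 * N - Nf))) := by
    refine ((tendsto_finsetProd _ fun j _ => ?_).mul (tendsto_finsetProd _ fun r _ => hm r)).mul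
      (tendsto_inv_norm_intCast.pow _)
    exact ((tendsto_const_nhds.mul (hα j)).inv₀ (by simpa using hε')).pow 2
  have hval : ((∏ _j : Fin N, ((‖ε‖ * 1)⁻¹) ^ 2) * ∏ _r : Fin Nf, ‖ε‖) * 0 ^ (2 * N - Nf)
      = (0 : ℝ) ^ (2 * N - Nf) := by
    rcases hN.eq_or_lt with h | h
    · simp only [Finset.prod_const, Finset.card_univ, Fintype.card_fin, mul_one, h, Nat.sub_self,
        pow_zero]
      rw [← pow_mul, ← mul_pow, inv_mul_cancel₀ hε', one_pow]
    · rw [zero_pow (by omega), mul_zero]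
  rw [hval] at hlim
  refine hlim.congr' ?_
  have hne : ∀ᶠ c : ℤ in cofinite, ∀ j, α i - α j + c ≠ 0 := by
    refine eventually_all.2 fun j => ?_
    filter_upwards [(hα j).eventually (lt_mem_nhds zero_lt_one)] with c hc h0
    rw [h0, norm_zero, zero_mul] at hc
    exact lt_irrefl _ hc
  filter_upwards [hne, eventually_intCast_ne_zero] with c hc hc0
  have ht : ‖(c : ℂ)‖⁻¹ ≠ 0 := inv_ne_zero (norm_ne_zero_iff.2 hc0)
  unfold boxBound
  have h1 : ∏ j, (‖ε‖⁻¹ * Real.exp (-logNorm (α i - α j + c))) ^ 2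
      = (∏ j, ((‖ε‖ * (‖α i - α j + c‖ * ‖(c : ℂ)‖⁻¹))⁻¹) ^ 2) * ‖(c : ℂ)‖⁻¹ ^ (2 * N) := by
    rw [pow_mul, show (‖(c : ℂ)‖⁻¹ ^ 2) ^ N = ∏ _j : Fin N, ‖(c : ℂ)‖⁻¹ ^ 2 by
      rw [Finset.prod_const, Finset.card_univ, Fintype.card_fin], ← Finset.prod_mul_distrib]
    refine Finset.prod_congr rfl fun j _ => ?_
    rw [logNorm, Real.exp_neg, Real.exp_log (norm_pos_iff.2 (hc j)), ← mul_pow]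
    congr 1
    rw [← mul_assoc, mul_inv _ ‖(c : ℂ)‖⁻¹, mul_assoc, inv_mul_cancel₀ ht, mul_one, mul_inv]
  rw [h1, Finset.prod_mul_distrib, Finset.prod_const, Finset.card_univ, Fintype.card_fin]
  rw [show 2 * N = Nf + (2 * N - Nf) by omega, pow_add, Nat.add_sub_cancel_left]
  ring

/-- The values tend to `0` as `|n| → ∞`, hence are bounded; an integer `z` is allowed because `0⁻¹ =
0`. -/
theorem exists_norm_inv_add_intCast_le (z : ℂ) : ∃ M : ℝ, ∀ n : ℤ, ‖(z + n)⁻¹‖ ≤ M := by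
  have h : Tendsto (fun c : ℤ => ‖(z + c)⁻¹‖) cofinite (𝓝 (1⁻¹ * 0)) := by
    have h1 := ((tendsto_norm_linear_div 1 z).inv₀ (by simp)).mul tendsto_inv_norm_intCast
    rw [norm_one] at h1
    refine h1.congr' ?_
    filter_upwards [eventually_intCast_ne_zero] with c hc
    rw [mul_inv, inv_inv, mul_assoc, mul_inv_cancel₀ (norm_ne_zero_iff.2 hc), mul_one, one_mul,
      norm_inv, add_comm]
  obtain ⟨M, hM⟩ := h.bddAbove_range_of_cofinite
  exact ⟨M, fun n => hM ⟨n, rfl⟩⟩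

theorem eventually_sqrt_mul_log_le (A B : ℝ) {δ : ℝ} (hδ : 0 < δ) :
    ∀ᶠ k : ℕ in atTop, ((Nat.sqrt k + 1 : ℕ) : ℝ) * (A * Real.log (k + 1) + B) ≤ δ * k := by
  have h1 : (fun x : ℝ => A * Real.log x + B) =o[atTop] fun x => x ^ (1 / 2 : ℝ) := by
    refine ((isLittleO_log_rpow_atTop (by norm_num)).const_mul_left A).add ?_
    exact Asymptotics.isLittleO_const_left.2
      (Or.inr (tendsto_norm_atTop_atTop.comp (tendsto_rpow_atTop (by norm_num))))
  have h2 : Tendsto (fun k : ℕ => (k : ℝ) + 1) atTop atTop :=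
    tendsto_atTop_add_const_right _ _ tendsto_natCast_atTop_atTop
  have h3 := h2.eventually (h1.bound (show (0 : ℝ) < δ / 4 by positivity))
  filter_upwards [h3, eventually_ge_atTop 1] with k hk hk1
  rw [← Real.sqrt_eq_rpow, Real.norm_of_nonneg (Real.sqrt_nonneg _)] at hk
  have hk2 := (le_abs_self _).trans hk
  have hk3 : (1 : ℝ) ≤ k := by exact_mod_cast hk1
  have hs : ((Nat.sqrt k + 1 : ℕ) : ℝ) ≤ 2 * Real.sqrt (k + 1) := by
    push_cast
    have e1 : (Nat.sqrt k : ℝ) ≤ Real.sqrt (k + 1) :=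
      Real.nat_sqrt_le_real_sqrt.trans (Real.sqrt_le_sqrt (by linarith))
    have e2 : 1 ≤ Real.sqrt (k + 1) := Real.one_le_sqrt.2 (by linarith)
    linarith
  have hsq : Real.sqrt ((k : ℝ) + 1) * Real.sqrt (k + 1) = k + 1 :=
    Real.mul_self_sqrt (by positivity)
  calc ((Nat.sqrt k + 1 : ℕ) : ℝ) * (A * Real.log (k + 1) + B)
      ≤ ((Nat.sqrt k + 1 : ℕ) : ℝ) * (δ / 4 * Real.sqrt (k + 1)) := by gcongr
    _ ≤ 2 * Real.sqrt (k + 1) * (δ / 4 * Real.sqrt (k + 1)) := by gcongr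
    _ = δ / 2 * (k + 1) := by linear_combination δ / 2 * hsq
    _ ≤ δ * k := by nlinarith

theorem prod_boxBound_le {N Nf k : ℕ} {ε : ℂ} {α : Fin N → ℂ} {m : Fin Nf → ℂ} {η K : ℝ}
    (hη : 0 < η) (hK : 1 ≤ K) {S : Finset ℤ}
    (hS : ∀ i, ∀ c ∉ S, boxBound ε α m i c ≤ η) (hall : ∀ i c, boxBound ε α m i c ≤ η * K)
    {Y : Fin N → YoungDiagram} (hY : Y ∈ youngTuples N k) :
    ∏ i, ∏ s ∈ (Y i).cells, boxBound ε α m i (content s)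
      ≤ η ^ k * K ^ (N * (S.card * (Nat.sqrt k + 1))) := by
  have h1 : ∀ i, ∏ s ∈ (Y i).cells, boxBound ε α m i (content s)
      ≤ η ^ (Y i).card * K ^ (S.card * (Nat.sqrt k + 1)) := by
    intro i
    calc ∏ s ∈ (Y i).cells, boxBound ε α m i (content s)
        ≤ ∏ s ∈ (Y i).cells, η * (if content s ∈ S then K else 1) := by
          refine Finset.prod_le_prod (fun _ _ => boxBound_nonneg _ _ _ _ _) fun s _ => ?_
          split_ifs with h
          · exact hall i _
          · rw [mul_one]
            exact hS i _ h
      _ = η ^ (Y i).card * K ^ ((Y i).cells.filter fun s => content s ∈ S).card := by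
          rw [Finset.prod_mul_distrib, Finset.prod_const, Finset.prod_ite, Finset.prod_const,
            Finset.prod_const_one, mul_one]
      _ ≤ _ := by
          gcongr
          exact card_content_mem_le (card_le_of_mem_youngTuples hY i) S
  calc ∏ i, ∏ s ∈ (Y i).cells, boxBound ε α m i (content s)
      ≤ ∏ i, η ^ (Y i).card * K ^ (S.card * (Nat.sqrt k + 1)) :=
        Finset.prod_le_prod (fun _ _ => Finset.prod_nonneg fun _ _ => boxBound_nonneg _ _ _ _ _)
          fun i _ => h1 i
    _ = η ^ k * K ^ (N * (S.card * (Nat.sqrt k + 1))) := by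
        rw [Finset.prod_mul_distrib, Finset.prod_pow_eq_pow_sum, mem_youngTuples.1 hY,
          Finset.prod_const, Finset.card_univ, Fintype.card_fin, ← pow_mul]
        congr 2
        ring

theorem sum_hookInteraction_le_of_mem {N k : ℕ} {α : Fin N → ℂ}
    (hgen : ∀ i j, i ≠ j → ∀ n : ℤ, α i - α j ≠ n) {M : ℝ} (hM1 : 1 ≤ M)
    (hM : ∀ i j, ∀ n : ℤ, ‖(α i - α j + n)⁻¹‖ ≤ M) {Y : Fin N → YoungDiagram}
    (hY : Y ∈ youngTuples N k) :
    ∑ i, ∑ j, hookInteraction (α i - α j) (Y i) (Y j)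
      ≤ ((Nat.sqrt k + 1 : ℕ) : ℝ) * (2 * N * Real.log (k + 1) + 2 * N * Real.log (1 + N * M)) := by
  refine (sum_hookInteraction_le hgen hM1 hM Y).trans ?_
  have hD : ∑ i, durfee (Y i) ≤ N * (Nat.sqrt k + 1) := by
    have := Finset.sum_le_card_nsmul Finset.univ (fun i => durfee (Y i)) _
      fun i _ => durfee_le (card_le_of_mem_youngTuples hY i)
    simpa using this
  generalize ∑ i, durfee (Y i) = D at hD
  have hs : Nat.sqrt k + 1 ≤ k + 1 := Nat.succ_le_succ (Nat.sqrt_le_self k)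
  generalize Nat.sqrt k + 1 = s at hD hs
  have hM0 : (0 : ℝ) ≤ N * M := by positivity
  have hlog : 0 ≤ Real.log (k + 1) + Real.log (1 + N * M) :=
    add_nonneg (Real.log_nonneg (by simp)) (Real.log_nonneg (by linarith))
  have hD' : (D : ℝ) ≤ N * s := by exact_mod_cast hD
  have hs' : (s : ℝ) ≤ k + 1 := by exact_mod_cast hs
  have hle : (D : ℝ) * Real.log (D * M) ≤ D * (Real.log (k + 1) + Real.log (1 + N * M)) := by
    rcases Nat.eq_zero_or_pos D with rfl | hpos
    · simp
    · have hDpos : (0 : ℝ) < D := by exact_mod_cast hpos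
      refine mul_le_mul_of_nonneg_left ?_ hDpos.le
      rw [← Real.log_mul (by positivity) (by positivity)]
      refine Real.log_le_log (by positivity) ?_
      calc (D : ℝ) * M ≤ (N * (k + 1)) * M := by gcongr; exact hD'.trans (by gcongr)
        _ ≤ (k + 1) * (1 + N * M) := by nlinarith [(Nat.cast_nonneg k : (0 : ℝ) ≤ k)]
  have := mul_le_mul_of_nonneg_right hD' hlog
  linarith

/-- Three subexponential losses multiply `η ^ k`: the number of tuples, the exceptional contents in
`S`, and the Cauchy determinant. The first and the last each contribute `2 * N` to the coefficient
of the logarithm. -/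
theorem norm_instantonCoeff_le {N Nf : ℕ} {ε : ℂ} {α : Fin N → ℂ} {m : Fin Nf → ℂ}
    (hgen : ∀ i j, i ≠ j → ∀ n : ℤ, α i - α j ≠ n) {M : ℝ} (hM1 : 1 ≤ M)
    (hM : ∀ i j, ∀ n : ℤ, ‖(α i - α j + n)⁻¹‖ ≤ M) {η K : ℝ} (hη : 0 < η) (hK : 1 ≤ K)
    {S : Finset ℤ} (hS : ∀ i, ∀ c ∉ S, boxBound ε α m i c ≤ η)
    (hall : ∀ i c, boxBound ε α m i c ≤ η * K) (k : ℕ) :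
    ‖instantonCoeff ε (-ε) (fun i => ε * α i) m k‖
      ≤ η ^ k * Real.exp (((Nat.sqrt k + 1 : ℕ) : ℝ) * (4 * N * Real.log (k + 1)
        + (2 * N * Real.log (1 + N * M) + N * S.card * Real.log K))) := by
  set s := Nat.sqrt k + 1 with hs
  unfold instantonCoeff
  have hterm : ∀ Y ∈ youngTuples N k,
      ‖zVect ε (-ε) (fun i => ε * α i) Y * ∏ r, zMatter ε (-ε) (fun i => ε * α i) Y (m r)‖
        ≤ η ^ k * K ^ (N * (S.card * s))
          * Real.exp (s * (2 * N * Real.log (k + 1) + 2 * N * Real.log (1 + N * M))) := by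
    intro Y hY
    refine (norm_term_le ε α m Y).trans ?_
    gcongr
    · exact prod_boxBound_le hη hK hS hall hY
    · exact sum_hookInteraction_le_of_mem hgen hM1 hM hY
  refine (norm_sum_le_of_le _ hterm).trans ?_
  rw [Finset.sum_const, nsmul_eq_mul]
  have hcard : ((youngTuples N k).card : ℝ) ≤ ((k : ℝ) + 1) ^ (2 * N * s) := by
    exact_mod_cast card_youngTuples_le N k
  refine (mul_le_mul_of_nonneg_right hcard (by positivity)).trans (le_of_eq ?_)
  have e1 : ((k : ℝ) + 1) ^ (2 * N * s) = Real.exp ((2 * N * s : ℕ) * Real.log (k + 1)) := by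
    rw [← Real.log_pow, Real.exp_log (by positivity)]
  have e2 : K ^ (N * (S.card * s)) = Real.exp ((N * (S.card * s) : ℕ) * Real.log K) := by
    rw [← Real.log_pow, Real.exp_log (by positivity)]
  rw [e1, e2, mul_assoc (η ^ k), ← Real.exp_add, mul_left_comm, ← Real.exp_add]
  congr 2
  push_cast
  ring

theorem eventually_norm_instantonCoeff_le {N Nf : ℕ} {ε : ℂ} (hε : ε ≠ 0) {α : Fin N → ℂ}
    (m : Fin Nf → ℂ) (hgen : ∀ i j, i ≠ j → ∀ n : ℤ, α i - α j ≠ n) (hN : Nf ≤ 2 * N) {θ : ℝ}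
    (hθ : 0 ^ (2 * N - Nf) < θ) :
    ∀ᶠ k : ℕ in atTop, ‖instantonCoeff ε (-ε) (fun i => ε * α i) m k‖ ≤ θ ^ k := by
  obtain ⟨η, hη1, hη2⟩ := exists_between hθ
  have hη : 0 < η := lt_of_le_of_lt (by positivity) hη1
  have hbox := tendsto_boxBound hε α m hN
  have hfin : {c : ℤ | ¬ ∀ i, boxBound ε α m i c ≤ η}.Finite :=
    eventually_cofinite.1 (eventually_all.2 fun i =>
      ((hbox i).eventually (gt_mem_nhds hη1)).mono fun _ h => h.le)
  choose b hb using fun i => (hbox i).bddAbove_range_of_cofinite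
  choose M hM using fun p : Fin N × Fin N => exists_norm_inv_add_intCast_le (α p.1 - α p.2)
  -- The factor is chosen so that `η` times it exceeds each global bound `b i` and it is itself at
  -- least `1`.
  have hall : ∀ i c, boxBound ε α m i c ≤ η * (1 + ∑ i, |b i| / η) := by
    intro i c
    have h1 : boxBound ε α m i c ≤ b i := hb i ⟨c, rfl⟩
    have h2 : |b i| / η ≤ ∑ i, |b i| / η :=
      Finset.single_le_sum (f := fun i => |b i| / η) (fun _ _ => by positivity) (Finset.mem_univ i)
    have h3 : η * (|b i| / η) = |b i| := mul_div_cancel₀ _ hη.ne'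
    nlinarith [le_abs_self (b i)]
  have hM' : ∀ i j, ∀ n : ℤ, ‖(α i - α j + n)⁻¹‖ ≤ 1 + ∑ p, |M p| := by
    intro i j n
    have h2 : |M (i, j)| ≤ ∑ p, |M p| :=
      Finset.single_le_sum (f := fun p => |M p|) (fun _ _ => by positivity)
        (Finset.mem_univ (i, j))
    linarith [hM (i, j) n, le_abs_self (M (i, j))]
  have hbound := norm_instantonCoeff_le (K := 1 + ∑ i, |b i| / η) (S := hfin.toFinset) (m := m)
    hgen (M := 1 + ∑ p, |M p|)
    (le_add_of_nonneg_right (Finset.sum_nonneg fun _ _ => by positivity)) hM' hη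
    (le_add_of_nonneg_right (Finset.sum_nonneg fun _ _ => by positivity))
    (fun i c hc => by
      rw [Set.Finite.mem_toFinset, Set.mem_ofPred_eq, not_not] at hc
      exact hc i) hall
  -- The gap between `η` and `θ` yields the exponential `(θ / η) ^ k` that absorbs `exp (O(√k log
  -- k))`.
  have hratio : 1 < θ / η := (one_lt_div hη).2 hη2
  filter_upwards [eventually_sqrt_mul_log_le (4 * N) (2 * N * Real.log (1 + N * (1 + ∑ p, |M p|))
    + N * hfin.toFinset.card * Real.log (1 + ∑ i, |b i| / η)) (Real.log_pos hratio)] with k hk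
  refine (hbound k).trans ?_
  calc η ^ k * Real.exp _ ≤ η ^ k * Real.exp (Real.log (θ / η) * k) := by gcongr
    _ = θ ^ k := by
      rw [mul_comm (Real.log _), ← Real.log_pow, Real.exp_log (by positivity), ← mul_pow,
        mul_div_cancel₀ _ hη.ne']

theorem summable_norm_instantonCoeff_mul_pow {N Nf : ℕ} {ε : ℂ} (hε : ε ≠ 0) {α : Fin N → ℂ}
    (m : Fin Nf → ℂ) (hgen : ∀ i j, i ≠ j → ∀ n : ℤ, α i - α j ≠ n) (hN : Nf ≤ 2 * N) {r : ℝ}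
    (hr : 0 ≤ r) (hr1 : 0 ^ (2 * N - Nf) * r < 1) :
    Summable fun k => ‖instantonCoeff ε (-ε) (fun i => ε * α i) m k‖ * r ^ k := by
  obtain ⟨θ, hθ, hθ1⟩ : ∃ θ : ℝ, 0 ^ (2 * N - Nf) < θ ∧ θ * r < 1 := by
    have hcont : Tendsto (fun θ : ℝ => θ * r) (𝓝[>] (0 ^ (2 * N - Nf)))
        (𝓝 (0 ^ (2 * N - Nf) * r)) :=
      ((continuous_id.mul continuous_const).tendsto _).mono_left nhdsWithin_le_nhds
    exact ((eventually_mem_nhdsWithin (s := Set.Ioi ((0 : ℝ) ^ (2 * N - Nf)))).and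
      (hcont.eventually (gt_mem_nhds hr1))).exists
  have hθ0 : 0 ≤ θ := le_trans (by positivity) hθ.le
  refine Summable.of_norm_bounded_eventually_nat
    (summable_geometric_of_lt_one (mul_nonneg hθ0 hr) hθ1) ?_
  filter_upwards [eventually_norm_instantonCoeff_le hε m hgen hN hθ] with k hk
  rw [Real.norm_of_nonneg (by positivity), mul_pow]
  gcongr

/-! ### Comparison with the explicit radius, and the theorem -/

theorem radiusBound_pos {N : ℕ} {α : Fin N → ℂ} (h : ∀ i j, i ≠ j → α i ≠ α j) :
    0 < radiusBound α := by
  refine Finset.prod_pos fun p hp => inv_pos.2 ?_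
  have h1 : 0 < ‖α p.1 - α p.2‖ :=
    norm_pos_iff.2 (sub_ne_zero.2 (h _ _ (Finset.mem_filter.1 hp).2))
  have h2 : 0 ≤ distInt (α p.1 - α p.2) := Real.iInf_nonneg fun _ => norm_nonneg _
  have h3 : 0 < min 1 ‖α p.1 - α p.2‖ := lt_min one_pos h1
  positivity

theorem radiusBound_le_one {N : ℕ} {α : Fin N → ℂ} (h : ∀ i j, i ≠ j → α i ≠ α j) :
    radiusBound α ≤ 1 := by
  refine Finset.prod_le_one (fun p _ => ?_) fun p hp => inv_le_one_of_one_le₀ ?_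
  all_goals have h2 : 0 ≤ distInt (α p.1 - α p.2) := Real.iInf_nonneg fun _ => norm_nonneg _
  · positivity
  · have h1 : 0 < ‖α p.1 - α p.2‖ :=
      norm_pos_iff.2 (sub_ne_zero.2 (h _ _ (Finset.mem_filter.1 hp).2))
    have h3 : 0 < min 1 ‖α p.1 - α p.2‖ := lt_min one_pos h1
    -- Each bracket is at least `16`, far more than needed: the series already converges on the open
    -- unit disc.
    refine one_le_mul_of_one_le_of_one_le ?_ ?_
    · rw [one_le_div h3]
      exact (min_le_left _ _).trans (by norm_num)
    · exact le_add_of_nonneg_right (by positivity)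

end Nekrasov

theorem mainTheorem2 (N Nf : ℕ) (ε : ℂ) (hε : ε ≠ 0) (a : Fin N → ℂ) (m : Fin Nf → ℂ)
    (α : Fin N → ℂ) (hα : ∀ i, α i = a i / ε)
    (hgen : ∀ i j, i < j → ∀ n : ℤ, α i - α j ≠ (n : ℂ)) :
    (Nf = 2 * N →
      0 < Nekrasov.radiusBound α ∧
      ENNReal.ofReal (Nekrasov.radiusBound α) ≤ (Nekrasov.instantonSeries ε (-ε) a m).radius ∧
      ∀ q : ℂ, ‖q‖ < Nekrasov.radiusBound α →
        Summable fun k : ℕ => ‖Nekrasov.instantonCoeff ε (-ε) a m k * q ^ k‖) ∧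
    (Nf < 2 * N →
      (Nekrasov.instantonSeries ε (-ε) a m).radius = ⊤ ∧
      ∀ q : ℂ, Summable fun k : ℕ => ‖Nekrasov.instantonCoeff ε (-ε) a m k * q ^ k‖) := by
  obtain rfl : a = fun i => ε * α i := funext fun i => by rw [hα, mul_div_cancel₀ _ hε]
  have hgen' : ∀ i j, i ≠ j → ∀ n : ℤ, α i - α j ≠ n := by
    intro i j hij n
    rcases lt_or_gt_of_ne hij with h | h
    · exact hgen i j h n
    · intro e
      refine hgen j i h (-n) ?_
      rw [← neg_sub, e, Int.cast_neg]
  have hinj : ∀ i j, i ≠ j → α i ≠ α j := fun i j hij e =>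
    hgen' i j hij 0 (by rw [e, sub_self, Int.cast_zero])
  have hradius : ∀ r : NNReal, (Summable fun k =>
      ‖Nekrasov.instantonCoeff ε (-ε) (fun i => ε * α i) m k‖ * (r : ℝ) ^ k) →
      (r : ENNReal) ≤ (Nekrasov.instantonSeries ε (-ε) (fun i => ε * α i) m).radius := by
    intro r hr
    refine FormalMultilinearSeries.le_radius_of_summable _ ?_
    simpa only [Nekrasov.instantonSeries, FormalMultilinearSeries.ofScalars_norm] using hr
  refine ⟨fun hN => ?_, fun hN => ?_⟩
  · have hsum : ∀ r : ℝ, 0 ≤ r → r < Nekrasov.radiusBound α → Summable fun k =>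
        ‖Nekrasov.instantonCoeff ε (-ε) (fun i => ε * α i) m k‖ * r ^ k := fun r hr0 hr =>
      Nekrasov.summable_norm_instantonCoeff_mul_pow hε m hgen' hN.le hr0 (by
        rw [hN, Nat.sub_self, pow_zero, one_mul]
        exact hr.trans_le (Nekrasov.radiusBound_le_one hinj))
    refine ⟨Nekrasov.radiusBound_pos hinj, ?_, fun q hq => ?_⟩
    · refine ENNReal.le_of_forall_nnreal_lt fun r hr => hradius r (hsum r r.2 ?_)
      rw [← ENNReal.ofReal_coe_nnreal] at hr
      exact ((ENNReal.ofReal_lt_ofReal_iff (Nekrasov.radiusBound_pos hinj)).1 hr)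
    · simpa only [norm_mul, norm_pow] using hsum ‖q‖ (norm_nonneg q) hq
  · have hsum : ∀ r : ℝ, 0 ≤ r → Summable fun k =>
        ‖Nekrasov.instantonCoeff ε (-ε) (fun i => ε * α i) m k‖ * r ^ k := fun r hr0 =>
      Nekrasov.summable_norm_instantonCoeff_mul_pow hε m hgen' hN.le hr0 (by
        rw [zero_pow (by omega), zero_mul]
        exact one_pos)
    refine ⟨ENNReal.eq_top_of_forall_nnreal_le fun r => hradius r (hsum r r.2), fun q => ?_⟩
    simpa only [norm_mul, norm_pow] using hsum ‖q‖ (norm_nonneg q)
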